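/- Let $\Theta\subset\mathbb{R}^d$ be compact and, for each $\theta\in\Theta$, let $P_\theta$ be a probability measure on a sample space $\mathcal{X}$ (a topological space with a $\sigma$-algebra containing the open sets), such that $\theta\mapsto P_\theta$ is injective and $\theta_m\to\theta$ in $\Theta$ if and only if $P_{\theta_m}\to P_\theta$ in distribution. Let $\mathcal{P}=\{P_\theta:\theta\in\Theta\}$, with the topology of convergence in distribution, be a statistical manifold: it carries a $C^\infty$ atlas of coordinate systems (homeomorphisms of open subsets of $\mathcal P$ onto subsets of $\mathbb{R}^d$, not necessarily open, with $C^\infty$ changes of coordinates) for which $\theta\mapsto P_\theta$ is a $C^\infty$ diffeomorphism of $\Theta$ onto $\mathcal P$. Here a map on an arbitrary subset of a Euclidean space is called $C^s$ if near each point of the subset it is the restriction of a $C^s$ map defined on the whole Euclidean space. Let $1\le s\le\infty$ and let $\mathcal{M}_s$ be the real vector space of $C^s$ functionals $m:\mathcal{P}\to\mathbb{R}$, i.e. those that are locally $C^s$ functions of the coordinates. (The smooth functionals are the case $s=\infty$.) 1. For every $m\in\mathcal{M}_s$, the function $\theta\mapsto m(P_\theta)$ is $C^s$ on $\Theta$.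 For $\mu=(\mu_1,\dots,\mu_{2d+1})\in\mathcal{M}_s^{2d+1}$, also write $\mu:\Theta\to\mathbb{R}^{2d+1}$ for the map $\theta\mapsto(\mu_1(P_\theta),\dots,\mu_{2d+1}(P_\theta))$, and call $\mu$ an embedding if this map is injective and its inverse $\mu(\Theta)\to\Theta$ is $C^s$. For $r\le s$, the $C^r$ topology on $\mathcal{M}_s^{2d+1}$, identified with the $C^s$ maps $\Theta\to\mathbb{R}^{2d+1}$, is the quotient topology under restriction to $\Theta$ of the space of $C^s$ maps $\mathbb{R}^d\to\mathbb{R}^{2d+1}$ with uniform convergence on compact sets of all derivatives of order at most $r$. 2. For every $r$ with $1\le r\le s$, the set of embeddings is open and dense in $\mathcal{M}_s^{2d+1}$ in the $C^r$ topology. 3. If $s\ge 2$ (in particular if $s=\infty$), embeddings are prevalent: there is a finite-dimensional linear subspace $E\subset\mathcal{M}_s^{2d+1}$ such that, for every $\mu\in\mathcal{M}_s^{2d+1}$, the perturbation $\mu+e$ is an embedding for Lebesgue-almost every $e\in E$. -/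

import Mathlib

open Topology Filter MeasureTheory
open scoped ContDiff UniformConvergence

/-- Euclidean space of dimension `d`. -/
abbrev Euc (d : ℕ) : Type := EuclideanSpace ℝ (Fin d)

/-- A function on an arbitrary subset `A` of a Euclidean space is of class `C^s` if near every point
of `A` it is the restriction of a `C^s` function on the whole space. -/
def IsClassOn {d : ℕ} {F : Type*} [NormedAddCommGroup F] [NormedSpace ℝ F] (s : ℕ∞)
    {A : Set (Euc d)} (f : A → F) : Prop :=
  ∀ x : A, ∃ g : Euc d → F, ContDiff ℝ s g ∧ ∀ᶠ y in 𝓝 x, f y = g y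

/-- `f : A → ℝᵏ` is a `C^s` embedding: it is of class `C^s` and it has an inverse, defined on its
image, which is of class `C^s`. -/
def IsClassEmbedding {d k : ℕ} (s : ℕ∞) {A : Set (Euc d)} (f : A → Euc k) : Prop :=
  IsClassOn s f ∧
    ∃ g : Set.range f → Euc d, IsClassOn s g ∧ ∀ x : A, g ⟨f x, Set.mem_range_self x⟩ = x

/-- A parametric statistical model on the sample space `X`: a compact parameter space `Θ ⊆ ℝᵈ` and a
probability measure `dist θ` for every `θ ∈ Θ`, such that distinct parameters give distinct
distributions, and convergence of parameters is the same as convergence in distribution. -/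
structure ParametricModel (d : ℕ) (X : Type*) [TopologicalSpace X] [MeasurableSpace X]
    [OpensMeasurableSpace X] where
  /-- the parameter space -/
  Θ : Set (Euc d)
  isCompact : IsCompact Θ
  /-- the model distributions -/
  dist : Θ → ProbabilityMeasure X
  dist_injective : Function.Injective dist
  tendsto_iff : ∀ (u : ℕ → Θ) (θ : Θ),
    Tendsto u atTop (𝓝 θ) ↔ Tendsto (fun n => dist (u n)) atTop (𝓝 (dist θ))

/-- A coordinate system on a topological space `S`: a homeomorphism of an open subset of `S` onto a
subset of `ℝᵈ` (which need not be open: manifolds with boundary or corners are included). The values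
outside `source` are irrelevant. -/
structure CoordSystem (d : ℕ) (S : Type*) [TopologicalSpace S] where
  source : Set S
  isOpen_source : IsOpen source
  toFun : S → Euc d
  isEmbedding : IsEmbedding (fun p : source => toFun p)

/-- Near `p`, the function `f` is a `C^s` function of the coordinates `c`. -/
def IsClassInCoord {d : ℕ} {S : Type*} [TopologicalSpace S] {F : Type*} [NormedAddCommGroup F]
    [NormedSpace ℝ F] (s : ℕ∞) (c : CoordSystem d S) (f : S → F) (p : S) : Prop :=
  ∃ G : Euc d → F, ContDiff ℝ s G ∧ ∀ᶠ q in 𝓝 p, f q = G (c.toFun q)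

namespace ParametricModel

variable {d : ℕ} {X : Type*} [TopologicalSpace X] [MeasurableSpace X] [OpensMeasurableSpace X]

/-- The family of model distributions, with the topology of convergence in distribution. -/
abbrev Family (M : ParametricModel d X) : Type _ := Set.range M.dist

/-- The parametrization `θ ↦ P_θ`, as a map onto the family. -/
def param (M : ParametricModel d X) (θ : M.Θ) : M.Family := ⟨M.dist θ, Set.mem_range_self θ⟩

/-- The parameter of a model distribution. -/
noncomputable def theta (M : ParametricModel d X) (p : M.Family) : Euc d :=
  ((Equiv.ofInjective M.dist M.dist_injective).symm p : M.Θ)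

/-- The structure of a statistical manifold on the family of model distributions: a smooth atlas of
coordinate systems for which `θ ↦ P_θ` is a diffeomorphism from `Θ` onto the family. Here `⊤ : ℕ∞` and
`∞` both mean infinitely differentiable. -/
structure StatisticalManifold (M : ParametricModel d X) where
  charts : Set (CoordSystem d M.Family)
  covers : ∀ p : M.Family, ∃ c ∈ charts, p ∈ c.source
  compatible : ∀ c ∈ charts, ∀ c' ∈ charts, ∀ p ∈ c.source ∩ c'.source,
    IsClassInCoord ⊤ c c'.toFun p
  smooth_param : ∀ c ∈ charts, ∀ θ : M.Θ, M.param θ ∈ c.source →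
    ∃ G : Euc d → Euc d, ContDiff ℝ ∞ G ∧ ∀ᶠ θ' in 𝓝 θ, c.toFun (M.param θ') = G θ'
  smooth_theta : ∀ c ∈ charts, ∀ p ∈ c.source, IsClassInCoord ⊤ c M.theta p

namespace StatisticalManifold

variable {M : ParametricModel d X} (A : M.StatisticalManifold)

/-- The real vector space of `C^s` functionals on the statistical manifold. -/
def functionals (s : ℕ∞) : Submodule ℝ (M.Family → ℝ) where
  carrier := {m | ∀ c ∈ A.charts, ∀ p ∈ c.source, IsClassInCoord s c m p}
  zero_mem' := fun _ _ _ _ => ⟨fun _ => 0, contDiff_const, by simp⟩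
  add_mem' := by
    intro m m' hm hm' c hc p hp
    obtain ⟨G, hG, h⟩ := hm c hc p hp
    obtain ⟨G', hG', h'⟩ := hm' c hc p hp
    refine ⟨fun x => G x + G' x, hG.add hG', ?_⟩
    filter_upwards [h, h'] with q h1 h2
    simp [h1, h2]
  smul_mem' := by
    intro a m hm c hc p hp
    obtain ⟨G, hG, h⟩ := hm c hc p hp
    refine ⟨fun x => a • G x, hG.const_smul a, ?_⟩
    filter_upwards [h] with q h1
    simp [h1]

/-- Collections of `k` functionals of class `C^s`. -/
abbrev Tuples (s : ℕ∞) (k : ℕ) : Type _ := Fin k → A.functionals s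

/-- The map `Θ → ℝᵏ` induced by `k` functionals, by composition with `θ ↦ P_θ`. -/
noncomputable def induced {s : ℕ∞} {k : ℕ} (μ : A.Tuples s k) (θ : M.Θ) : Euc k :=
  WithLp.toLp 2 fun i => (μ i : M.Family → ℝ) (M.param θ)

/-- The collections of `k` functionals that form an embedding of `Θ` in `ℝᵏ`. -/
def embeddings (s : ℕ∞) (k : ℕ) : Set (A.Tuples s k) :=
  {μ | IsClassEmbedding s (A.induced μ)}

end StatisticalManifold

end ParametricModel

/-- The `C^s` maps `ℝᵈ → ℝᵏ`. -/
def ClassMap (s : ℕ∞) (d k : ℕ) : Type := {F : Euc d → Euc k // ContDiff ℝ s F}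

/-- The `C^r` topology on the `C^s` maps `ℝᵈ → ℝᵏ` (for `r ≤ s`): uniform convergence on compact sets
of all the derivatives of order at most `r`. -/
@[reducible] noncomputable def ClassMap.topology (r s : ℕ∞) (d k : ℕ) : TopologicalSpace (ClassMap s d k) :=
  ⨅ j : {j : ℕ // (j : ℕ∞) ≤ r}, TopologicalSpace.induced
    (fun F : ClassMap s d k =>
      UniformOnFun.ofFun {K : Set (Euc d) | IsCompact K} (iteratedFDeriv ℝ j.1 F.1))
    inferInstance

namespace ParametricModel.StatisticalManifold

variable {d : ℕ} {X : Type*} [TopologicalSpace X] [MeasurableSpace X] [OpensMeasurableSpace X]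
  {M : ParametricModel d X} (A : M.StatisticalManifold)

theorem comp_theta_mem {s : ℕ∞} {f : Euc d → ℝ} (hf : ContDiff ℝ s f) :
    (fun p => f (M.theta p)) ∈ A.functionals s := by
  intro c hc p hp
  obtain ⟨G, hG, h⟩ := A.smooth_theta c hc p hp
  refine ⟨f ∘ G, hf.comp (hG.of_le (WithTop.coe_le_coe.2 le_top)), ?_⟩
  filter_upwards [h] with q hq
  simp [hq]

/-- The restriction of a `C^s` map `ℝᵈ → ℝᵏ` to `Θ`, as a collection of functionals. -/
noncomputable def restrict {s : ℕ∞} {k : ℕ} (F : ClassMap s d k) : A.Tuples s k :=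
  fun i => ⟨fun p => F.1 (M.theta p) i, A.comp_theta_mem ((contDiff_euclidean).1 F.2 i)⟩

/-- The `C^r` topology on collections of `k` functionals of class `C^s`: since these are the `C^s`
maps `Θ → ℝᵏ`, that is, the restrictions to `Θ` of `C^s` maps `ℝᵈ → ℝᵏ`, they carry the quotient
topology. -/
@[reducible] noncomputable def topology (r s : ℕ∞) (k : ℕ) : TopologicalSpace (A.Tuples s k) :=
  TopologicalSpace.coinduced A.restrict (ClassMap.topology r s d k)

end ParametricModel.StatisticalManifold

/-- A subset `S` of a real vector space is prevalent if there is a finite-dimensional subspace (with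
basis `b`) such that, for every vector `v`, the perturbation `v + e` belongs to `S` for
Lebesgue-almost every `e` in that subspace. -/
def IsPrevalent {V : Type*} [AddCommGroup V] [Module ℝ V] (S : Set V) : Prop :=
  ∃ (N : ℕ) (b : Fin N → V), LinearIndependent ℝ b ∧
    ∀ v : V, ∀ᵐ t : Fin N → ℝ, v + ∑ i, t i • b i ∈ S

/-! Composition with the parametrization identifies tuples of functionals with restrictions to the
compact set `Θ` of globally defined `C^s` maps, so everything reduces to maps `F` from `ℝᵈ` to `ℝᵏ`
with `2d < k`. Openness: an embedding has a compactly supported `C^s` left inverse `G`. If `F'` is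
`C¹`-close to `F` on a ball containing the range of `G`, then `y ↦ y + (F' - F)(G y)` is a
contractive perturbation of the identity. Composing `G` with its inverse gives a left inverse of
`F'` (`exists_pos_isClassEmbedding_of_fderiv_sub_le`). Genericity is a Whitney-type dimension count.
For `F` of class `C²`, the matrices `a` for which `F + a` fails to be an injective immersion lie in
finitely many `C¹` images of spaces of dimension `(d-1)k + 2d < dk`, hence in a null set
(`ae_forall_sum_smul_matrixUnitMap_ne`). An injective immersion embeds every compact set. This gives
prevalence, with linear maps as probe space, and density, since sets of full measure are dense. For
`s = 1`, mollification first replaces `F` by a smooth map. -/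

/-! ### Global extension of `C^s` functions -/

/-- A function which near every point of a closed set `K` agrees on `K` with a `C^s` function is on
`K` the restriction of a global `C^s` function. -/
theorem exists_contDiff_eqOn_of_local {E F : Type*} [NormedAddCommGroup E] [NormedSpace ℝ E]
    [FiniteDimensional ℝ E] [NormedAddCommGroup F] [NormedSpace ℝ F] {s : ℕ∞} {K : Set E}
    (hK : IsClosed K) (f : E → F)
    (hf : ∀ x ∈ K, ∃ U ∈ 𝓝 x, ∃ g : E → F, ContDiffOn ℝ s g U ∧ ∀ y ∈ U, y ∈ K → g y = f y) :
    ∃ g : E → F, ContDiff ℝ s g ∧ ∀ y ∈ K, g y = f y := by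
  -- The constraint is a single point over `K` and vacuous elsewhere: both are convex, so a
  -- partition of unity glues local solutions.
  obtain ⟨g, hg⟩ := exists_contMDiffMap_forall_mem_convex_of_local (n := s)
    (modelWithCornersSelf ℝ E) (M := E) (F := F) (t := fun x => {z | x ∈ K → z = f x})
    (fun x => by
      by_cases hx : x ∈ K
      · simp [hx]
      · simp [hx, convex_univ])
    (fun x => by
      by_cases hx : x ∈ K
      · obtain ⟨U, hU, g, hg, h⟩ := hf x hx
        exact ⟨U, hU, g, hg.contMDiffOn, h⟩
      · exact ⟨Kᶜ, hK.isOpen_compl.mem_nhds hx, fun _ => 0, contMDiffOn_const,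
          fun y hy hy' => absurd hy' hy⟩)
  exact ⟨g, g.contMDiff.contDiff, hg⟩

theorem exists_contDiff_hasCompactSupport_eqOn {E F : Type*} [NormedAddCommGroup E]
    [NormedSpace ℝ E] [FiniteDimensional ℝ E] [NormedAddCommGroup F] [NormedSpace ℝ F] {s : ℕ∞}
    {K : Set E} (hK : IsCompact K) {f : E → F} (hf : ContDiff ℝ s f) :
    ∃ g : E → F, ContDiff ℝ s g ∧ HasCompactSupport g ∧ ∀ y ∈ K, g y = f y := by
  obtain ⟨R, hR, hKR⟩ := hK.isBounded.exists_pos_norm_le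
  let φ : ContDiffBump (0 : E) := ⟨R, R + 1, hR, by linarith⟩
  refine ⟨fun x => φ x • f x, φ.contDiff.smul hf, φ.hasCompactSupport.smul_right, fun y hy => ?_⟩
  have : φ y = 1 := φ.one_of_mem_closedBall (by simpa using hKR y hy)
  simp [this]

theorem IsClassOn.exists_contDiff {n : ℕ} {F : Type*} [NormedAddCommGroup F] [NormedSpace ℝ F]
    {s : ℕ∞} {K : Set (Euc n)} (hK : IsCompact K) {f : K → F} (hf : IsClassOn s f) :
    ∃ g : Euc n → F, ContDiff ℝ s g ∧ HasCompactSupport g ∧ ∀ x : K, g x = f x := by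
  classical
  obtain ⟨g, hg, h⟩ := exists_contDiff_eqOn_of_local (s := s) hK.isClosed
    (fun x => if hx : x ∈ K then f ⟨x, hx⟩ else 0) (by
      intro x hx
      obtain ⟨g, hg, h⟩ := hf ⟨x, hx⟩
      obtain ⟨U, hU, hUg⟩ := (mem_nhds_subtype _ _ _).1 h
      exact ⟨U, hU, g, hg.contDiffOn, fun y hy hyK => by
        simpa [hyK] using (@hUg ⟨y, hyK⟩ hy).symm⟩)
  obtain ⟨g', hg', hc, h'⟩ := exists_contDiff_hasCompactSupport_eqOn hK hg
  exact ⟨g', hg', hc, fun x => by rw [h' x x.2, h x x.2]; simp⟩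

/-! ### Left inverses and stability of embeddings -/

/-- A perturbation of the identity by a contraction of class `C^s` has a global inverse of class
`C^s`. -/
theorem exists_contDiff_leftInverse_id_add {E : Type*} [NormedAddCommGroup E] [NormedSpace ℝ E]
    [FiniteDimensional ℝ E] {s : ℕ∞} (hs : 1 ≤ s) {h : E → E} (hh : ContDiff ℝ s h)
    {c : NNReal} (hc : c < 1) (hL : LipschitzWith c h) :
    ∃ g : E → E, ContDiff ℝ s g ∧ ∀ x, g (x + h x) = x := by
  have : CompleteSpace E := FiniteDimensional.complete ℝ E
  have hs' : (1 : WithTop ℕ∞) ≤ s := by exact_mod_cast hs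
  have hA : ApproximatesLinearOn (fun x => x + h x)
      ((ContinuousLinearEquiv.refl ℝ E : E ≃L[ℝ] E) : E →L[ℝ] E) Set.univ c := by
    intro x _ y _
    have := hL.dist_le_mul x y
    rw [dist_eq_norm, dist_eq_norm] at this
    calc ‖x + h x - (y + h y) - (x - y)‖ = ‖h x - h y‖ := by congr 1; abel
      _ ≤ _ := this
  have hc' : Subsingleton E ∨
      c < ‖((ContinuousLinearEquiv.refl ℝ E).symm : E →L[ℝ] E)‖₊⁻¹ := by
    rcases subsingleton_or_nontrivial E with hE | hE
    · exact Or.inl hE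
    · right
      have : ‖((ContinuousLinearEquiv.refl ℝ E).symm : E →L[ℝ] E)‖₊ = 1 := by
        exact (nnnorm_one : ‖(1 : E →L[ℝ] E)‖₊ = 1)
      rwa [this, inv_one]
  -- A kernel vector satisfies `‖v‖ ≤ c‖v‖` with `c < 1`; invertible derivatives make the inverse
  -- homeomorphism `C^s`.
  have hinj : ∀ a, Function.Injective (ContinuousLinearMap.id ℝ E + fderiv ℝ h a) := by
    intro a
    rw [injective_iff_map_eq_zero]
    intro v hv
    have h1 : v = -fderiv ℝ h a v := by
      rw [eq_neg_iff_add_eq_zero]; simpa using hv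
    have h2 : ‖v‖ ≤ c * ‖v‖ := by
      conv_lhs => rw [h1, norm_neg]
      exact (fderiv ℝ h a).le_of_opNorm_le (norm_fderiv_le_of_lipschitz ℝ hL) v
    have h3 : (c : ℝ) < 1 := hc
    by_contra hv0
    have := norm_pos_iff.2 hv0
    nlinarith
  let e := hA.toHomeomorph _ hc'
  have he : ∀ x, e x = x + h x := fun x => rfl
  have hsymm := e.contDiff_symm (𝕜 := ℝ) (n := s)
    (f₀' := fun a => (LinearEquiv.ofInjectiveEndo
      ((ContinuousLinearMap.id ℝ E + fderiv ℝ h a : E →L[ℝ] E) : E →ₗ[ℝ] E)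
      (hinj a)).toContinuousLinearEquiv) (by
      intro a
      have : HasFDerivAt (fun x => x + h x) (ContinuousLinearMap.id ℝ E + fderiv ℝ h a) a :=
        (hasFDerivAt_id a).add (hh.differentiable (by positivity) a).hasFDerivAt
      exact this) (contDiff_id.add hh)
  exact ⟨e.symm, hsymm, fun x => by rw [← he, e.symm_apply_apply]⟩

/-- An embedding of a compact set has a globally defined left inverse. -/
theorem isClassEmbedding_iff_exists_leftInverse {d k : ℕ} {s : ℕ∞} {K : Set (Euc d)}
    (hK : IsCompact K) {F : Euc d → Euc k} (hF : ContDiff ℝ s F) :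
    IsClassEmbedding s (fun x : K => F x) ↔
      ∃ G : Euc k → Euc d, ContDiff ℝ s G ∧ HasCompactSupport G ∧ ∀ x ∈ K, G (F x) = x := by
  have hcpt : IsCompact (Set.range fun x : K => F x) := by
    have : CompactSpace K := isCompact_iff_compactSpace.1 hK
    exact isCompact_range (hF.continuous.comp continuous_subtype_val)
  constructor
  · rintro ⟨-, g, hg, h⟩
    obtain ⟨G, hG, hc, hGg⟩ := hg.exists_contDiff hcpt
    exact ⟨G, hG, hc, fun x hx => by
      exact (hGg ⟨F x, ⟨⟨x, hx⟩, rfl⟩⟩).trans (h ⟨x, hx⟩)⟩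
  · rintro ⟨G, hG, -, h⟩
    exact ⟨fun x => ⟨F, hF, .of_forall fun _ => rfl⟩, fun y => G y,
      fun x => ⟨G, hG, .of_forall fun _ => rfl⟩, fun x => h x x.2⟩

/-- Embeddings of a compact set are stable under perturbations with small derivative. -/
theorem exists_pos_isClassEmbedding_of_fderiv_sub_le {d k : ℕ} {s : ℕ∞} (hs : 1 ≤ s)
    {K : Set (Euc d)} (hK : IsCompact K) {F : Euc d → Euc k} (hF : ContDiff ℝ s F)
    (hE : IsClassEmbedding s (fun x : K => F x)) :
    ∃ R : ℝ, ∃ ε > 0, ∀ F' : Euc d → Euc k, ContDiff ℝ s F' →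
      (∀ x ∈ Metric.closedBall (0 : Euc d) R, ‖fderiv ℝ F' x - fderiv ℝ F x‖ ≤ ε) →
      IsClassEmbedding s (fun x : K => F' x) := by
  have hs' : (1 : WithTop ℕ∞) ≤ s := by exact_mod_cast hs
  obtain ⟨G, hG, hc, hGF⟩ := (isClassEmbedding_iff_exists_leftInverse hK hF).1 hE
  obtain ⟨C, hC⟩ := (hG.of_le hs').lipschitzWith_of_hasCompactSupport hc one_ne_zero
  -- `F' - F` is only evaluated on the range of `G`, so closeness on one ball suffices.
  obtain ⟨R, hR⟩ := (hc.isCompact_range hG.continuous).isBounded.subset_closedBall 0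
  have hCpos : (0 : ℝ) < 2 * (C + 1) := by positivity
  refine ⟨R, (2 * (C + 1))⁻¹, inv_pos.2 hCpos, fun F' hF' hsmall => ?_⟩
  have hH : ContDiff ℝ s (fun x => F' x - F x) := hF'.sub hF
  let ε : NNReal := (2 * (C + 1))⁻¹
  have hLip : LipschitzOnWith ε (fun x => F' x - F x) (Metric.closedBall 0 R) := by
    refine (convex_closedBall _ _).lipschitzOnWith_of_nnnorm_fderiv_le (𝕜 := ℝ)
      (fun x _ => hH.differentiable (by positivity) x) fun x hx => ?_
    rw [fderiv_fun_sub (hF'.differentiable (by positivity) x)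
      (hF.differentiable (by positivity) x)]
    simpa [ε, ← NNReal.coe_le_coe] using hsmall x hx
  have hcomp : LipschitzWith (ε * C) (fun y => F' (G y) - F (G y)) := by
    rw [← lipschitzOnWith_univ] at hC ⊢
    exact hLip.comp hC fun y _ => hR ⟨y, rfl⟩
  have hlt : ε * C < 1 := by
    have : (0 : NNReal) < 2 * (C + 1) := by positivity
    rw [show ε * C = C / (2 * (C + 1)) by rw [div_eq_inv_mul], div_lt_one this]
    rw [← NNReal.coe_lt_coe]; push_cast
    have := C.2
    simp only [NNReal.val_eq_coe] at this
    linarith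
  -- At `y = F x` the perturbed identity takes the value `F' x`, so `Ψ (F' x) = F x` and `G ∘ Ψ`
  -- inverts `F'` on `K`.
  obtain ⟨Ψ, hΨ, hinv⟩ := exists_contDiff_leftInverse_id_add hs (hH.comp hG) hlt hcomp
  refine ⟨fun x => ⟨F', hF', .of_forall fun _ => rfl⟩, fun y => G (Ψ y),
      fun x => ⟨G ∘ Ψ, hG.comp hΨ, .of_forall fun _ => rfl⟩, fun x => ?_⟩
  have h1 := hinv (F x)
  simp only [Function.comp, hGF x x.2, add_sub_cancel] at h1
  simp only [h1, hGF x x.2]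

/-! ### Injective immersions of compact sets -/

/-- An immersion has local left inverses. -/
theorem ContDiff.exists_eventually_leftInverse {E E' : Type*} [NormedAddCommGroup E]
    [NormedSpace ℝ E] [FiniteDimensional ℝ E] [NormedAddCommGroup E'] [NormedSpace ℝ E']
    [FiniteDimensional ℝ E'] {s : ℕ∞} (hs : 1 ≤ s) {F : E → E'} (hF : ContDiff ℝ s F) {x₀ : E}
    (hinj : Function.Injective (fderiv ℝ F x₀)) :
    ∃ G : E' → E, ContDiff ℝ s G ∧ ∀ᶠ x in 𝓝 x₀, G (F x) = x := by
  have : CompleteSpace E := FiniteDimensional.complete ℝ E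
  have hs' : (s : WithTop ℕ∞) ≠ 0 := by
    have : (1 : WithTop ℕ∞) ≤ s := by exact_mod_cast hs
    positivity
  -- A linear left inverse of the derivative reduces the claim to the inverse function theorem for
  -- `L ∘ F`, whose derivative at `x₀` is the identity.
  obtain ⟨L, hL⟩ := (fderiv ℝ F x₀ : E →ₗ[ℝ] E').exists_leftInverse_of_injective
    (LinearMap.ker_eq_bot.2 hinj)
  let L' : E' →L[ℝ] E := LinearMap.toContinuousLinearMap L
  have hΦ : ContDiff ℝ s (fun x => L' (F x)) := L'.contDiff.comp hF
  have hΦ' : HasFDerivAt (fun x => L' (F x))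
      ((ContinuousLinearEquiv.refl ℝ E : E ≃L[ℝ] E) : E →L[ℝ] E) x₀ := by
    have h := L'.hasFDerivAt.comp x₀ (hF.differentiable hs' x₀).hasFDerivAt
    have hid : L'.comp (fderiv ℝ F x₀) = ((ContinuousLinearEquiv.refl ℝ E : E ≃L[ℝ] E) : E →L[ℝ] E) :=
      ContinuousLinearMap.ext fun v => LinearMap.congr_fun hL v
    rwa [hid] at h
  let e := hΦ.contDiffAt.toOpenPartialHomeomorph _ hΦ' hs'
  have he : ∀ x, e x = L' (F x) := fun x => rfl
  have hx₀ : x₀ ∈ e.source := hΦ.contDiffAt.mem_toOpenPartialHomeomorph_source hΦ' hs'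
  -- The local inverse is `C^s` at the images of points where the derivative is invertible; this is
  -- an open condition.
  let O : Set E := {x | fderiv ℝ (fun x => L' (F x)) x ∈
    Set.range ((↑) : (E ≃L[ℝ] E) → E →L[ℝ] E)}
  have hO : IsOpen O := (ContinuousLinearEquiv.isOpen (𝕜 := ℝ) (E := E) (F := E)).preimage
    (hΦ.continuous_fderiv hs')
  have hW : IsOpen (e.target ∩ e.symm ⁻¹' O) := e.isOpen_inter_preimage_symm hO
  have hmem : e x₀ ∈ e.target ∩ e.symm ⁻¹' O :=
    ⟨e.map_source hx₀, by
      rw [Set.mem_preimage, e.left_inv hx₀]; exact ⟨_, hΦ'.fderiv.symm⟩⟩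
  have hsmooth : ContDiffOn ℝ s e.symm (e.target ∩ e.symm ⁻¹' O) := by
    rintro y ⟨hy, f', hf'⟩
    refine (e.contDiffAt_symm (f₀' := f') hy ?_ hΦ.contDiffAt).contDiffWithinAt
    rw [hf']
    exact (hΦ.differentiable hs' _).hasFDerivAt
  obtain ⟨ρ, hρ, hball⟩ := Metric.nhds_basis_closedBall.mem_iff.1 (hW.mem_nhds hmem)
  obtain ⟨g, hg, hge⟩ := exists_contDiff_eqOn_of_local (s := s)
    (Metric.isClosed_closedBall (x := e x₀) (ε := ρ)) e.symm
    (fun x hx => ⟨_, hW.mem_nhds (hball hx), e.symm, hsmooth, fun _ _ _ => rfl⟩)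
  refine ⟨fun y => g (L' y), hg.comp L'.contDiff, ?_⟩
  filter_upwards [e.open_source.mem_nhds hx₀,
    hΦ.continuous.continuousAt.preimage_mem_nhds (Metric.closedBall_mem_nhds (L' (F x₀)) hρ)]
    with x hx hx'
  exact (hge _ hx').trans (e.left_inv hx)

/-- An injective immersion restricts to an embedding of every compact set. -/
theorem isClassEmbedding_of_injOn_of_injective_fderiv {d k : ℕ} {s : ℕ∞} (hs : 1 ≤ s)
    {K : Set (Euc d)} (hK : IsCompact K) {F : Euc d → Euc k} (hF : ContDiff ℝ s F)
    (hinj : Set.InjOn F K) (himm : ∀ x ∈ K, Function.Injective (fderiv ℝ F x)) :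
    IsClassEmbedding s (fun x : K => F x) := by
  have : CompactSpace K := isCompact_iff_compactSpace.1 hK
  have hemb : IsEmbedding (fun x : K => F x) :=
    ((hF.continuous.comp continuous_subtype_val).isClosedEmbedding
      hinj.injective).isEmbedding
  let e := hemb.toHomeomorph
  have hsymm : ∀ x : K, e.symm ⟨F x, x, rfl⟩ = x := fun x => e.symm_apply_apply x
  refine ⟨fun x => ⟨F, hF, .of_forall fun _ => rfl⟩, fun y => e.symm y, ?_, fun x => ?_⟩
  · rintro ⟨_, x₀, rfl⟩
    obtain ⟨G, hG, h⟩ := hF.exists_eventually_leftInverse hs (himm x₀ x₀.2)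
    refine ⟨G, hG, ?_⟩
    -- By compactness the inverse on the image is continuous: image points near `F x₀` come from
    -- points near `x₀`, where `G` inverts `F`.
    have ht : Tendsto (fun y => (e.symm y : Euc d)) (𝓝 ⟨F x₀, x₀, rfl⟩) (𝓝 x₀) := by
      have := (continuous_subtype_val.comp e.symm.continuous).tendsto ⟨F x₀, x₀, rfl⟩
      rwa [Function.comp, hsymm] at this
    filter_upwards [ht.eventually h]
    rintro ⟨_, x, rfl⟩ hx
    rw [hsymm] at hx ⊢
    exact hx.symm
  · exact congrArg Subtype.val (hsymm x)

/-! ### Dimension count for linear perturbations -/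

/-- The linear maps `ℝᵈ → ℝᵏ` whose matrices have a single non-zero entry. -/
noncomputable def matrixUnitMap {d k : ℕ} (p : Fin d × Fin k) : Euc d →L[ℝ] Euc k :=
  (EuclideanSpace.proj p.1 : Euc d →L[ℝ] ℝ).smulRight (EuclideanSpace.single p.2 1)

theorem sum_smul_matrixUnitMap_apply {d k : ℕ} (a : Fin d × Fin k → ℝ) (x : Euc d) (i : Fin k) :
    (∑ p, a p • matrixUnitMap p x) i = ∑ j, a (j, i) * x j := by
  simp [matrixUnitMap, Fintype.sum_prod_type, Pi.single_apply]

/-- An easy case of Sard's theorem: `C¹` maps do not raise Hausdorff dimension, and volume is the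
Hausdorff measure of the target dimension. -/
theorem volume_image_eq_zero_of_finrank_lt {E ι : Type*} [NormedAddCommGroup E] [NormedSpace ℝ E]
    [FiniteDimensional ℝ E] [Fintype ι] {f : E → ι → ℝ} {t : Set E} (hf : ContDiffOn ℝ 1 f t)
    (ht : Convex ℝ t) (h : Module.finrank ℝ E < Fintype.card ι) : volume (f '' t) = 0 := by
  rw [← hausdorffMeasure_pi_real]
  have : dimH (f '' t) < (Fintype.card ι : NNReal) := by
    calc dimH (f '' t) ≤ dimH t := hf.dimH_image_le ht subset_rfl
      _ ≤ dimH (Set.univ : Set E) := dimH_mono (Set.subset_univ t)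
      _ = Module.finrank ℝ E := Real.dimH_univ_eq_finrank E
      _ < _ := by exact_mod_cast h
  exact_mod_cast hausdorffMeasure_of_dimH_lt this

/-- If `2d < k`, then for almost every linear map `ℝᵈ → ℝᵏ` the equation `a w = Q (x, w)` has no
solution with `w ≠ 0`. -/
theorem ae_forall_sum_smul_matrixUnitMap_ne {d k : ℕ} (hk : 2 * d < k)
    {Q : Euc d × Euc d → Euc k} (hQ : ContDiff ℝ 1 Q) :
    ∀ᵐ a : Fin d × Fin k → ℝ, ∀ x w : Euc d, w ≠ 0 → ∑ p, a p • matrixUnitMap p w ≠ Q (x, w) := by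
  -- When `w j ≠ 0`, the equation determines the entries `a (j, ·)` from the other entries and `(x,
  -- w)`; `Ψ j` is this solution map.
  let D := fun j : Fin d => ({j' : Fin d // j' ≠ j} × Fin k → ℝ) × (Euc d × Euc d)
  let Ψ : ∀ j : Fin d, D j → Fin d × Fin k → ℝ := fun j z p =>
    if h : p.1 ≠ j then z.1 (⟨p.1, h⟩, p.2)
    else (Q z.2 p.2 - ∑ j' : {j' : Fin d // j' ≠ j}, z.1 (j', p.2) * z.2.2 j') / z.2.2 j
  have hΨ : ∀ j (t : Set (D j)), (∀ z ∈ t, z.2.2 j ≠ 0) → ContDiffOn ℝ 1 (Ψ j) t := by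
    intro j t ht
    rw [contDiffOn_pi]
    intro p
    by_cases hp : p.1 ≠ j
    · simp only [Ψ, dif_pos hp]
      exact ((contDiff_apply ℝ ℝ (⟨p.1, hp⟩, p.2)).comp
        (contDiff_fst (E := {j' : Fin d // j' ≠ j} × Fin k → ℝ) (F := Euc d × Euc d))).contDiffOn
    · simp only [Ψ, dif_neg hp]
      have hcoord : ∀ j' : Fin d, ContDiff ℝ 1 (fun z : D j => z.2.2 j') := fun j' => by fun_prop
      refine ContDiffOn.div (ContDiff.contDiffOn ?_) (hcoord j).contDiffOn ht
      refine ((contDiff_euclidean.1 hQ p.2).comp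
        (contDiff_snd (E := {j' : Fin d // j' ≠ j} × Fin k → ℝ) (F := Euc d × Euc d))).sub (ContDiff.sum fun j' _ => ?_)
      exact ((contDiff_apply ℝ ℝ (j', p.2)).comp
        (contDiff_fst (E := {j' : Fin d // j' ≠ j} × Fin k → ℝ) (F := Euc d × Euc d))).mul (hcoord j')
  have hrank : ∀ j : Fin d, Module.finrank ℝ (D j) < Fintype.card (Fin d × Fin k) := by
    intro j
    have hd : 0 < d := j.pos
    obtain ⟨d, rfl⟩ : ∃ d', d = d' + 1 := ⟨d - 1, by omega⟩
    simp [D, Module.finrank_prod]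
    nlinarith
  -- The dimension bound needs a convex domain, so `w j ≠ 0` is split into two half-spaces.
  have hnull : ∀ j, volume (Ψ j '' {z | 0 < z.2.2 j}) = 0 ∧
      volume (Ψ j '' {z | z.2.2 j < 0}) = 0 := by
    intro j
    let ℓ : D j →ₗ[ℝ] ℝ := (EuclideanSpace.proj j : Euc d →L[ℝ] ℝ).toLinearMap ∘ₗ
      LinearMap.snd ℝ _ _ ∘ₗ LinearMap.snd ℝ _ _
    exact ⟨volume_image_eq_zero_of_finrank_lt (hΨ j _ fun z hz => ne_of_gt hz)
        (convex_halfSpace_gt ℓ.isLinear 0) (hrank j),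
      volume_image_eq_zero_of_finrank_lt (hΨ j _ fun z hz => ne_of_lt hz)
        (convex_halfSpace_lt ℓ.isLinear 0) (hrank j)⟩
  have hae : ∀ᵐ a : Fin d × Fin k → ℝ, ∀ j,
      a ∉ Ψ j '' {z | 0 < z.2.2 j} ∧ a ∉ Ψ j '' {z | z.2.2 j < 0} :=
    ae_all_iff.2 fun j => (measure_eq_zero_iff_ae_notMem.1 (hnull j).1).and
      (measure_eq_zero_iff_ae_notMem.1 (hnull j).2)
  filter_upwards [hae] with a ha x w hw heq
  obtain ⟨j, hj⟩ : ∃ j, w j ≠ 0 := by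
    by_contra! h
    exact hw (PiLp.ext h)
  have hmem : Ψ j (fun q => a (q.1, q.2), (x, w)) = a := by
    ext ⟨j', i⟩
    by_cases hp : j' ≠ j
    · simp [Ψ, hp]
    · obtain rfl : j' = j := not_not.1 hp
      have h := congrArg (fun v : Euc k => v i) heq
      simp only [sum_smul_matrixUnitMap_apply] at h
      rw [Fintype.sum_eq_add_sum_subtype_ne _ j'] at h
      simp only [Ψ, hp, dif_neg, not_false_eq_true]
      rw [div_eq_iff hj, ← h]
      ring
  rcases lt_or_gt_of_ne hj with h | h
  · exact (ha j).2 ⟨_, h, hmem⟩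
  · exact (ha j).1 ⟨_, h, hmem⟩

/-- If `2d < k`, then almost every linear perturbation of a `C²` map `ℝᵈ → ℝᵏ` is an injective
immersion. -/
theorem ae_injective_and_injective_fderiv {d k : ℕ} (hk : 2 * d < k) {F : Euc d → Euc k}
    (hF : ContDiff ℝ 2 F) :
    ∀ᵐ a : Fin d × Fin k → ℝ, Function.Injective (fun x => F x + ∑ p, a p • matrixUnitMap p x) ∧
      ∀ x, Function.Injective (fderiv ℝ (fun x => F x + ∑ p, a p • matrixUnitMap p x) x) := by
  have hF1 : ContDiff ℝ 1 F := hF.of_le one_le_two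
  have hF' : ContDiff ℝ 1 (fderiv ℝ F) := hF.fderiv_right (by norm_num [one_add_one_eq_two])
  -- A double point `x`, `x + w` means `a w = F x - F (x + w)`, and a kernel vector `w` at `x` means
  -- `a w = -DF(x) w`. The second right-hand side is `C¹` because `F` is `C²`.
  have h1 : ContDiff ℝ 1 (fun z : Euc d × Euc d => F z.1 - F (z.1 + z.2)) := by fun_prop
  have h2 : ContDiff ℝ 1 (fun z : Euc d × Euc d => -fderiv ℝ F z.1 z.2) :=
    ((hF'.comp contDiff_fst).clm_apply contDiff_snd).neg
  filter_upwards [ae_forall_sum_smul_matrixUnitMap_ne hk h1,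
    ae_forall_sum_smul_matrixUnitMap_ne hk h2] with a ha1 ha2
  constructor
  · intro x y hxy
    by_contra hne
    refine ha1 x (y - x) (sub_ne_zero.2 (Ne.symm hne)) ?_
    simp only [map_sub, smul_sub, Finset.sum_sub_distrib, add_sub_cancel]
    rw [sub_eq_sub_iff_add_eq_add, add_comm]
    exact hxy.symm
  · intro x
    have hderiv : HasFDerivAt (fun x => F x + ∑ p, a p • matrixUnitMap p x)
        (fderiv ℝ F x + ∑ p, a p • matrixUnitMap p) x := by
      refine (hF1.differentiable one_ne_zero x).hasFDerivAt.add ?_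
      exact HasFDerivAt.fun_sum fun p _ => (matrixUnitMap p).hasFDerivAt.const_smul (a p)
    rw [hderiv.fderiv, injective_iff_map_eq_zero]
    intro w hw
    by_contra hne
    refine ha2 x w hne ?_
    rw [eq_neg_iff_add_eq_zero, add_comm]
    simpa using hw

/-! ### Mollification -/

/-- A compactly supported `C¹` map is uniformly `C¹`-close to smooth maps. -/
theorem exists_contDiff_dist_lt_and_fderiv_dist_lt {E F : Type*} [NormedAddCommGroup E]
    [NormedSpace ℝ E] [FiniteDimensional ℝ E] [NormedAddCommGroup F] [NormedSpace ℝ F]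
    [CompleteSpace F] {f : E → F} (hf : ContDiff ℝ 1 f) (hc : HasCompactSupport f) {ε : ℝ}
    (hε : 0 < ε) :
    ∃ g : E → F, ContDiff ℝ ∞ g ∧ ∀ x, dist (g x) (f x) < ε ∧
      dist (fderiv ℝ g x) (fderiv ℝ f x) < ε := by
  borelize E
  let μ : Measure E := Measure.addHaar
  have hf' := hf.continuous_fderiv one_ne_zero
  obtain ⟨δ₁, hδ₁, h₁⟩ := Metric.uniformContinuous_iff.1
    (hc.uniformContinuous_of_continuous hf.continuous) (ε / 2) (half_pos hε)
  obtain ⟨δ₂, hδ₂, h₂⟩ := Metric.uniformContinuous_iff.1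
    ((hc.fderiv ℝ).uniformContinuous_of_continuous hf') (ε / 2) (half_pos hε)
  have hδ : 0 < min δ₁ δ₂ := lt_min hδ₁ hδ₂
  let φ : ContDiffBump (0 : E) := ⟨min δ₁ δ₂ / 2, min δ₁ δ₂, half_pos hδ, half_lt_self hδ⟩
  let L := ContinuousLinearMap.lsmul ℝ ℝ (E := F)
  refine ⟨convolution (φ.normed μ) f L μ, φ.hasCompactSupport_normed.contDiff_convolution_left _
    φ.contDiff_normed hf.continuous.locallyIntegrable, fun x => ⟨?_, ?_⟩⟩
  · refine (φ.dist_normed_convolution_le hf.continuous.aestronglyMeasurable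
      fun y hy => (h₁ ?_).le).trans_lt (half_lt_self hε)
    exact lt_of_lt_of_le hy (min_le_left _ _)
  -- The derivative falls on `f`, so the same estimate applies to the mollified derivative.
  · have hd := hc.hasFDerivAt_convolution_right L
      (φ.continuous_normed (μ := μ)).locallyIntegrable hf x (μ := μ)
    have hL : L.precompR E = ContinuousLinearMap.lsmul ℝ ℝ (E := E →L[ℝ] F) := by
      ext; rfl
    rw [hd.fderiv, hL]
    refine (φ.dist_normed_convolution_le hf'.aestronglyMeasurable
      fun y hy => (h₂ ?_).le).trans_lt (half_lt_self hε)
    exact lt_of_lt_of_le hy (min_le_right _ _)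

/-! ### The `C^r` topology -/

namespace ClassMap

variable {d k : ℕ} {r s : ℕ∞}

/-- The perturbation of a map by a linear combination of maps. -/
noncomputable def perturb {ι : Type*} [Fintype ι] (F : ClassMap s d k) (H : ι → ClassMap s d k)
    (t : ι → ℝ) : ClassMap s d k :=
  ⟨fun x => F.1 x + ∑ i, t i • (H i).1 x,
    F.2.add (ContDiff.sum fun i _ => (H i).2.const_smul (t i))⟩

theorem tendsto_nhds_iff {α : Type*} {l : Filter α} {u : α → ClassMap s d k}
    {F : ClassMap s d k} :
    Tendsto u l (@nhds _ (ClassMap.topology r s d k) F) ↔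
      ∀ j : ℕ, (j : ℕ∞) ≤ r → ∀ K : Set (Euc d), IsCompact K →
        TendstoUniformlyOn (fun a => iteratedFDeriv ℝ j (u a).1) (iteratedFDeriv ℝ j F.1) l K := by
  rw [ClassMap.topology, nhds_iInf]
  simp only [nhds_induced, tendsto_iInf, tendsto_comap_iff,
    UniformOnFun.tendsto_iff_tendstoUniformlyOn, Subtype.forall]
  rfl

/-- The derivatives are jointly continuous in `(t, x)`; currying turns this into continuity in `t`
for uniform convergence on compact sets. -/
theorem continuous_perturb (hr : r ≤ s) {ι : Type*} [Fintype ι] (F : ClassMap s d k)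
    (H : ι → ClassMap s d k) :
    @Continuous _ _ _ (ClassMap.topology r s d k) (F.perturb H) := by
  refine continuous_iInf_rng.2 fun ⟨j, hj⟩ => continuous_induced_rng.2 ?_
  have hjs : (j : WithTop ℕ∞) ≤ s := by exact_mod_cast hj.trans hr
  have hcont : Continuous fun z : (ι → ℝ) × Euc d => iteratedFDeriv ℝ j (F.perturb H z.1).1 z.2 := by
    have heq : ∀ z : (ι → ℝ) × Euc d, iteratedFDeriv ℝ j (F.perturb H z.1).1 z.2 =
        iteratedFDeriv ℝ j F.1 z.2 + ∑ i, z.1 i • iteratedFDeriv ℝ j (H i).1 z.2 := by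
      intro z
      have hH : ∀ i, ContDiff ℝ j (H i).1 := fun i => (H i).2.of_le hjs
      have hF : ContDiff ℝ j F.1 := F.2.of_le hjs
      have hsum : ContDiff ℝ j fun x => ∑ i, (z.1 i • (H i).1) x :=
        ContDiff.sum fun i _ => (hH i).const_smul (z.1 i)
      refine (iteratedFDeriv_add_apply hF.contDiffAt hsum.contDiffAt).trans (congrArg _ ?_)
      refine (iteratedFDeriv_fun_sum_apply (f := fun i => z.1 i • (H i).1) fun i _ =>
        ((hH i).const_smul (z.1 i)).contDiffAt).trans ?_
      exact Finset.sum_congr rfl fun i _ =>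
        iteratedFDeriv_const_smul_apply (hH i).contDiffAt
    simp_rw [heq]
    have hF := F.2.continuous_iteratedFDeriv hjs
    have hH := fun i => (H i).2.continuous_iteratedFDeriv hjs
    fun_prop
  let Φ : C((ι → ℝ) × Euc d, _) := ⟨_, hcont⟩
  exact ContinuousMap.isUniformEmbedding_toUniformOnFunIsCompact.uniformContinuous.continuous.comp
    Φ.curry.continuous

theorem norm_iteratedFDeriv_one_sub {E F : Type*} [NormedAddCommGroup E] [NormedSpace ℝ E]
    [NormedAddCommGroup F] [NormedSpace ℝ F] {f g : E → F} (hf : ContDiff ℝ 1 f)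
    (hg : ContDiff ℝ 1 g) (x : E) :
    ‖iteratedFDeriv ℝ 1 f x - iteratedFDeriv ℝ 1 g x‖ = ‖fderiv ℝ f x - fderiv ℝ g x‖ := by
  rw [← iteratedFDeriv_sub_apply (by exact_mod_cast hf.contDiffAt)
    (by exact_mod_cast hg.contDiffAt), norm_iteratedFDeriv_one,
    fderiv_sub (hf.differentiable one_ne_zero x) (hg.differentiable one_ne_zero x)]

theorem fderiv_sub_le_mem_nhds (hr : 1 ≤ r) (hs : 1 ≤ s) (F : ClassMap s d k) (R : ℝ) {ε : ℝ}
    (hε : 0 < ε) :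
    {F' : ClassMap s d k | ∀ x ∈ Metric.closedBall (0 : Euc d) R,
      ‖fderiv ℝ F'.1 x - fderiv ℝ F.1 x‖ ≤ ε} ∈ @nhds _ (ClassMap.topology r s d k) F := by
  have hs' : (1 : WithTop ℕ∞) ≤ s := by exact_mod_cast hs
  have h := tendsto_nhds_iff.1 (tendsto_id (α := ClassMap s d k)
    (x := @nhds _ (ClassMap.topology r s d k) F)) 1 (by exact_mod_cast hr) _
    (isCompact_closedBall (0 : Euc d) R)
  filter_upwards [Metric.tendstoUniformlyOn_iff.1 h ε hε] with F' hF' x hx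
  have := hF' x hx
  rw [dist_comm, dist_eq_norm] at this
  exact (norm_iteratedFDeriv_one_sub (F'.2.of_le hs') (F.2.of_le hs') x).symm.trans_le this.le

/-- Smooth maps approximate compactly supported `C¹` maps in the `C¹` topology. -/
theorem exists_contDiff_mem_of_mem_nhds (F : ClassMap 1 d k) (hF : HasCompactSupport F.1)
    {U : Set (ClassMap 1 d k)} (hU : U ∈ @nhds _ (ClassMap.topology 1 1 d k) F) :
    ∃ F' ∈ U, ContDiff ℝ ∞ F'.1 := by
  have hF1 : ContDiff ℝ 1 F.1 := by exact_mod_cast F.2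
  choose g hg hgF using fun n : ℕ =>
    exists_contDiff_dist_lt_and_fderiv_dist_lt hF1 hF (Nat.one_div_pos_of_nat (α := ℝ) (n := n))
  have hg1 : ∀ n, ContDiff ℝ 1 (g n) := fun n => (hg n).of_le (by exact_mod_cast le_top)
  let u : ℕ → ClassMap 1 d k := fun n => ⟨g n, by exact_mod_cast hg1 n⟩
  have hu : Tendsto u atTop (@nhds _ (ClassMap.topology 1 1 d k) F) := by
    refine tendsto_nhds_iff.2 fun j hj K _ => Metric.tendstoUniformlyOn_iff.2 fun ε hε => ?_
    have hlim := tendsto_one_div_add_atTop_nhds_zero_nat (𝕜 := ℝ)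
    filter_upwards [hlim.eventually_lt_const hε] with n hn x _
    obtain rfl | rfl : j = 0 ∨ j = 1 := by
      have : j ≤ 1 := by exact_mod_cast hj
      omega
    · rw [dist_comm, dist_eq_norm, ← iteratedFDeriv_sub_apply
        ((hg1 n).of_le zero_le_one).contDiffAt
        (hF1.of_le zero_le_one).contDiffAt, norm_iteratedFDeriv_zero]
      have := (hgF n x).1.trans hn
      rwa [dist_eq_norm] at this
    · rw [dist_comm, dist_eq_norm]
      have := (hgF n x).2.trans hn
      rw [dist_eq_norm] at this
      exact (norm_iteratedFDeriv_one_sub (hg1 n) hF1 x).trans_lt this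
  obtain ⟨n, hn⟩ := (hu.eventually_mem hU).exists
  exact ⟨u n, hn, hg n⟩

end ClassMap

/-! ### Prevalence -/

/-- A set which absorbs almost all linear combinations of a finite family of vectors, and whose
traces on finite-dimensional affine subspaces are open, is prevalent. -/
theorem isPrevalent_of_ae_add_sum_smul_mem {V : Type*} [AddCommGroup V] [Module ℝ V] {T : Set V}
    {ι : Type*} [Fintype ι] (u : ι → V)
    (hopen : ∀ (N : ℕ) (b : Fin N → V) (v : V),
      IsOpen {t : Fin N → ℝ | v + ∑ i, t i • b i ∈ T})
    (hae : ∀ v : V, ∀ᵐ a : ι → ℝ, v + ∑ i, a i • u i ∈ T) : IsPrevalent T := by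
  -- The vectors `u` may be dependent, so the probe is their span. Null sets transfer along the
  -- surjection `L`, with measurability supplied by `hopen`.
  let S := LinearMap.range (Fintype.linearCombination ℝ u)
  let b := Module.finBasis ℝ S
  let L : (ι → ℝ) →ₗ[ℝ] (Fin (Module.finrank ℝ S) → ℝ) :=
    b.equivFun.toLinearMap ∘ₗ (Fintype.linearCombination ℝ u).rangeRestrict
  have hL : Function.Surjective L :=
    b.equivFun.surjective.comp (LinearMap.surjective_rangeRestrict _)
  refine ⟨_, fun i => (b i : V),
    b.linearIndependent.map' S.subtype (Submodule.ker_subtype S), fun v => ?_⟩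
  refine (ae_comp_linearMap_mem_iff (L := L) volume volume hL
    (hopen _ (fun i => (b i : V)) v).measurableSet).1 ?_
  filter_upwards [hae v] with a ha
  have hsum : ∑ i, L a i • (b i : V) = ∑ i, a i • u i := by
    have := congrArg Subtype.val (b.sum_equivFun ((Fintype.linearCombination ℝ u).rangeRestrict a))
    rw [Submodule.coe_sum] at this
    exact this
  rwa [← hsum] at ha

/-! ### Transfer to the statistical manifold -/

namespace ParametricModel

variable {d : ℕ} {X : Type*} [TopologicalSpace X] [MeasurableSpace X] [OpensMeasurableSpace X]
  {M : ParametricModel d X}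

/-- Sequential continuity is enough because `Θ` is metrizable. -/
theorem continuous_param : Continuous M.param := by
  refine Continuous.subtype_mk (SeqContinuous.continuous fun u θ h => ?_) _
  exact (M.tendsto_iff u θ).1 h

theorem theta_param (θ : M.Θ) : M.theta (M.param θ) = θ :=
  congrArg Subtype.val ((Equiv.ofInjective M.dist M.dist_injective).symm_apply_apply θ)

namespace StatisticalManifold

variable (A : M.StatisticalManifold) {r s : ℕ∞} {k : ℕ}


theorem isClassOn_of_mem_functionals {m : M.Family → ℝ} (hm : m ∈ A.functionals s) :
    IsClassOn s (fun θ : M.Θ => m (M.param θ)) := by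
  intro θ
  obtain ⟨c, hc, hp⟩ := A.covers (M.param θ)
  obtain ⟨G, hG, h⟩ := hm c hc _ hp
  obtain ⟨G', hG', h'⟩ := A.smooth_param c hc θ hp
  refine ⟨G ∘ G', hG.comp (hG'.of_le (WithTop.coe_le_coe.2 le_top)), ?_⟩
  filter_upwards [continuous_param.continuousAt.eventually h, h'] with θ' h1 h2
  rw [h1, h2, Function.comp]

/-- Surjectivity of `restrict` makes the quotient topology meaningful; the compact support serves
the mollification. -/
theorem exists_restrict_eq (μ : A.Tuples s k) :
    ∃ F : ClassMap s d k, HasCompactSupport F.1 ∧ A.restrict F = μ := by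
  choose g hg hc hgμ using fun i =>
    (A.isClassOn_of_mem_functionals (μ i).2).exists_contDiff M.isCompact
  obtain ⟨F, hF, hFc, hFg⟩ := exists_contDiff_hasCompactSupport_eqOn M.isCompact
    (f := fun x => (WithLp.toLp 2 fun i => g i x : Euc k)) (s := s) (contDiff_euclidean.2 hg)
  refine ⟨⟨F, hF⟩, hFc, ?_⟩
  ext i ⟨_, θ, rfl⟩
  change F (M.theta (M.param θ)) i = _
  rw [theta_param, hFg θ θ.2]
  exact hgμ i θ

theorem induced_restrict (F : ClassMap s d k) :
    A.induced (A.restrict F) = fun θ : M.Θ => F.1 θ := by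
  funext θ
  ext i
  change F.1 (M.theta (M.param θ)) i = _
  rw [theta_param]

theorem restrict_mem_embeddings_iff {F : ClassMap s d k} :
    A.restrict F ∈ A.embeddings s k ↔ IsClassEmbedding s (fun θ : M.Θ => F.1 θ) := by
  rw [embeddings, Set.mem_ofPred_eq, induced_restrict]

theorem restrict_perturb {ι : Type*} [Fintype ι] (F : ClassMap s d k) (H : ι → ClassMap s d k)
    (t : ι → ℝ) :
    A.restrict (F.perturb H t) = A.restrict F + ∑ i, t i • A.restrict (H i) := by
  ext i p
  simp [restrict, ClassMap.perturb]

theorem isOpen_embeddings (hr : 1 ≤ r) (hs : 1 ≤ s) :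
    IsOpen[A.topology r s k] (A.embeddings s k) := by
  let _ := ClassMap.topology r s d k
  refine isOpen_coinduced.2 (isOpen_iff_mem_nhds.2 fun F hF => ?_)
  obtain ⟨R, ε, hε, h⟩ := exists_pos_isClassEmbedding_of_fderiv_sub_le hs M.isCompact F.2
    (A.restrict_mem_embeddings_iff.1 hF)
  filter_upwards [F.fderiv_sub_le_mem_nhds hr hs R hε] with F' hF'
  exact A.restrict_mem_embeddings_iff.2 (h F'.1 F'.2 hF')

theorem continuous_restrict_perturb (hr : r ≤ s) {ι : Type*} [Fintype ι] (F : ClassMap s d k)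
    (H : ι → ClassMap s d k) :
    @Continuous _ _ _ (A.topology r s k) fun t => A.restrict (F.perturb H t) := by
  let _ := ClassMap.topology r s d k
  let _ := A.topology r s k
  exact (continuous_coinduced_rng (f := A.restrict)).comp (F.continuous_perturb hr H)

/-- The matrix units, as `C^s` maps. -/
noncomputable def _root_.ClassMap.matrixUnit (s : ℕ∞) (p : Fin d × Fin k) : ClassMap s d k :=
  ⟨matrixUnitMap p, (matrixUnitMap p).contDiff⟩

theorem ae_restrict_perturb_mem_embeddings (hs : 1 ≤ s) (hk : 2 * d < k) (F : ClassMap s d k)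
    (hF : ContDiff ℝ 2 F.1) :
    ∀ᵐ a : Fin d × Fin k → ℝ,
      A.restrict (F.perturb (ClassMap.matrixUnit s) a) ∈ A.embeddings s k := by
  filter_upwards [ae_injective_and_injective_fderiv hk hF] with a ha
  exact A.restrict_mem_embeddings_iff.2 (isClassEmbedding_of_injOn_of_injective_fderiv hs
    M.isCompact (F.perturb (ClassMap.matrixUnit s) a).2 ha.1.injOn fun x _ => ha.2 x)

theorem dense_embeddings (hr : r ≤ s) (hs : 1 ≤ s) (hr1 : 1 ≤ r) (hk : 2 * d < k) :
    @Dense _ (A.topology r s k) (A.embeddings s k) := by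
  let _ := ClassMap.topology r s d k
  let _ := A.topology r s k
  -- One `C²` representative in `W` is enough: its perturbations by small matrices stay in `W`, and
  -- almost all are embeddings.
  have key : ∀ W : Set (A.Tuples s k), IsOpen[A.topology r s k] W → ∀ F : ClassMap s d k,
      ContDiff ℝ 2 F.1 → A.restrict F ∈ W → (W ∩ A.embeddings s k).Nonempty := by
    intro W hW F hF hFW
    have hopen : IsOpen ((fun t => A.restrict (F.perturb (ClassMap.matrixUnit s) t)) ⁻¹' W) :=
      @IsOpen.preimage _ _ _ (A.topology r s k) _
        (A.continuous_restrict_perturb hr F (ClassMap.matrixUnit s)) _ hW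
    have hne : ((fun t => A.restrict (F.perturb (ClassMap.matrixUnit s) t)) ⁻¹' W).Nonempty :=
      ⟨0, by simpa [restrict_perturb] using hFW⟩
    obtain ⟨t, ht, htE⟩ := (Measure.dense_of_ae
      (A.ae_restrict_perturb_mem_embeddings hs hk F hF)).inter_open_nonempty _ hopen hne
    exact ⟨_, ht, htE⟩
  refine (@dense_iff_inter_open _ (A.topology r s k) _).2 fun W hW ⟨μ, hμ⟩ => ?_
  obtain ⟨F, hFc, rfl⟩ := A.exists_restrict_eq μ
  by_cases h2 : 2 ≤ s
  · exact key W hW F (F.2.of_le (WithTop.coe_le_coe.2 h2)) hμ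
  -- Here `r = s = 1`, and a smooth map `C¹`-close to `F` replaces it inside the preimage of `W`.
  · obtain rfl : s = 1 := le_antisymm (by
      by_contra h1
      exact h2 (by simpa [one_add_one_eq_two] using Order.add_one_le_of_lt (not_le.1 h1))) hs
    obtain rfl : r = 1 := le_antisymm hr hr1
    obtain ⟨F', hF', hsm⟩ := F.exists_contDiff_mem_of_mem_nhds hFc
      ((isOpen_coinduced.1 hW).mem_nhds hμ)
    exact key W hW F' (hsm.of_le (WithTop.coe_le_coe.2 le_top)) hF'

theorem isPrevalent_embeddings (hs : 2 ≤ s) (hk : 2 * d < k) :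
    IsPrevalent (A.embeddings s k) := by
  have hs1 : 1 ≤ s := one_le_two.trans hs
  refine isPrevalent_of_ae_add_sum_smul_mem (fun p => A.restrict (ClassMap.matrixUnit s p))
    (fun N b v => ?_) fun v => ?_
  · obtain ⟨F, -, rfl⟩ := A.exists_restrict_eq v
    choose H _ hH using fun i => A.exists_restrict_eq (b i)
    have heq : ∀ t : Fin N → ℝ,
        A.restrict F + ∑ i, t i • b i = A.restrict (F.perturb H t) := by
      intro t
      rw [restrict_perturb]
      simp only [hH]
    simp only [heq]
    -- Prevalence involves no topology; the `C^s` one serves only to show that the traces are open.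
    exact @IsOpen.preimage _ _ _ (A.topology s s k) _
      (A.continuous_restrict_perturb le_rfl F H) _ (A.isOpen_embeddings hs1 hs1)
  · obtain ⟨F, -, rfl⟩ := A.exists_restrict_eq v
    filter_upwards [A.ae_restrict_perturb_mem_embeddings hs1 hk F
      (F.2.of_le (WithTop.coe_le_coe.2 hs))] with a ha
    rwa [restrict_perturb] at ha

end StatisticalManifold

end ParametricModel

theorem mainTheorem3 {d : ℕ} {X : Type*} [TopologicalSpace X] [MeasurableSpace X]
    [OpensMeasurableSpace X] (M : ParametricModel d X) (A : M.StatisticalManifold)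
    (s : ℕ∞) (hs : 1 ≤ s) :
    (∀ m ∈ A.functionals s, IsClassOn s (fun θ : M.Θ => m (M.param θ))) ∧
    (∀ r : ℕ∞, 1 ≤ r → r ≤ s →
      IsOpen[A.topology r s (2 * d + 1)] (A.embeddings s (2 * d + 1)) ∧
      @Dense _ (A.topology r s (2 * d + 1)) (A.embeddings s (2 * d + 1))) ∧
    (2 ≤ s → IsPrevalent (A.embeddings s (2 * d + 1))) :=
  ⟨fun _ hm => A.isClassOn_of_mem_functionals hm,
    fun _ h1 hr => ⟨A.isOpen_embeddings h1 hs,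
      A.dense_embeddings hr hs h1 (Nat.lt_succ_self _)⟩,
    fun h2 => A.isPrevalent_embeddings h2 (Nat.lt_succ_self _)⟩
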